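/- Let $m,n\ge 1$ be integers. For $\mathbf{x}\in\mathbb{R}^n$ let $S^-(\mathbf{x})$ denote the number of sign changes in the sequence $x_1,\dots,x_n$ after discarding all zero entries, with $S^-(\mathbf{0}):=0$. Let $\epsilon=(\epsilon_1,\dots,\epsilon_{\min\{m,n\}})$ with every $\epsilon_r\in\{1,-1\}$, and put $\epsilon_0:=1$. A matrix $A\in\mathbb{R}^{m\times n}$ is called $\mathrm{SR}(\epsilon)$ if, for every $1\le r\le\min\{m,n\}$, every non-zero $r\times r$ minor of $A$ has sign $\epsilon_r$. Let $A\in\mathbb{R}^{m\times n}$. For every $k\times k$ submatrix $A_k$ of $A$ (given by $k$ increasing row indices and $k$ increasing column indices, $1\le k\le\min\{m,n\}$) fix an arbitrary vector $\boldsymbol{\alpha}^{A_k}=(\alpha_1,-\alpha_2,\dots,(-1)^{k-1}\alpha_k)^T\in\mathbb{R}^k$ with all $\alpha_j>0$, and put $\mathbf{y}^{A_k}:=\operatorname{adj}(A_k)\,\boldsymbol{\alpha}^{A_k}$, where the adjugate of a $1\times1$ matrix is $(1)$. Then, for any such choice of the vectors $\boldsymbol{\alpha}^{A_k}$, the following are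 equivalent. 1. $A$ is $\mathrm{SR}(\epsilon)$. 2. For all $\mathbf{x}\in\mathbb{R}^n$ we have $S^-(A\mathbf{x})\le S^-(\mathbf{x})$. Moreover, for all $\mathbf{x}\in\mathbb{R}^n$ with $A\mathbf{x}\ne\mathbf{0}$ and $S^-(A\mathbf{x})=S^-(\mathbf{x})=r$, if $0\le r\le\min\{m,n\}-1$, then the sign of the first (respectively last) non-zero component of $A\mathbf{x}$ equals $\epsilon_r\epsilon_{r+1}$ times the sign of the first (respectively last) non-zero component of $\mathbf{x}$. 3. For every $1\le k\le\min\{m,n\}$ and every $k\times k$ submatrix $A_k$ of $A$ we have $S^-(A_k\mathbf{y}^{A_k})\le S^-(\mathbf{y}^{A_k})$. Moreover, if $A_k\mathbf{y}^{A_k}\ne\mathbf{0}$ and $S^-(A_k\mathbf{y}^{A_k})=S^-(\mathbf{y}^{A_k})=r$ with $0\le r\le k-1$, then the sign of the first (respectively last) non-zero component of $A_k\mathbf{y}^{A_k}$ equals $\epsilon_r\epsilon_{r+1}$ times the sign of the first (respectively last) non-zero component of $\mathbf{y}^{A_k}$. -/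

import Mathlib

noncomputable section

namespace SignRegular

/-- The signs of the non-zero entries of `x`, in order. -/
def nonzeroSigns {n : ℕ} (x : Fin n → ℝ) : List SignType :=
  ((List.ofFn x).map SignType.sign).filter (· ≠ 0)

/-- `S⁻(x)`: the number of sign changes in `x` after discarding all zero entries. Collapsing runs
of equal signs leaves one entry more than there are sign changes; the zero vector gives `0`. -/
def signChanges {n : ℕ} (x : Fin n → ℝ) : ℕ :=
  ((nonzeroSigns x).destutter (· ≠ ·)).length - 1

/-- The sign of the first non-zero entry of `x` (and `0` for the zero vector). -/
def firstSign {n : ℕ} (x : Fin n → ℝ) : SignType := (nonzeroSigns x).headD 0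

/-- The sign of the last non-zero entry of `x` (and `0` for the zero vector). -/
def lastSign {n : ℕ} (x : Fin n → ℝ) : SignType := (nonzeroSigns x).getLastD 0

/-- The entry `ε_r` of a sign pattern `(ε_1, …, ε_N)`, with `ε_0 = 1`.
Indices above `N` are never used. -/
def sgn {N : ℕ} (ε : Fin N → SignType) (r : ℕ) : SignType :=
  if h : 1 ≤ r ∧ r ≤ N then ε ⟨r - 1, by omega⟩ else 1

/-- `A` is SR(ε): every non-zero `r × r` minor of `A` has sign `ε_r`, for `1 ≤ r ≤ min m n`. -/
def IsSR {m n : ℕ} (ε : Fin (min m n) → SignType) (A : Matrix (Fin m) (Fin n) ℝ) : Prop :=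
  ∀ r : ℕ, 1 ≤ r → r ≤ min m n → ∀ (I : Fin r ↪o Fin m) (J : Fin r ↪o Fin n),
    (A.submatrix I J).det ≠ 0 → SignType.sign (A.submatrix I J).det = sgn ε r

/-- The variation diminishing condition for the matrix `B` at the vector `x`, with the sign
condition (relative to the pattern `ε`) in the case of equality. -/
def VDAt {N p q : ℕ} (ε : Fin N → SignType) (B : Matrix (Fin p) (Fin q) ℝ)
    (x : Fin q → ℝ) : Prop :=
  signChanges (B.mulVec x) ≤ signChanges x ∧
  ∀ r : ℕ, B.mulVec x ≠ 0 → signChanges (B.mulVec x) = r → signChanges x = r →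
    r < min p q →
      firstSign (B.mulVec x) = sgn ε r * sgn ε (r + 1) * firstSign x ∧
      lastSign (B.mulVec x) = sgn ε r * sgn ε (r + 1) * lastSign x

/-- The vector `(a_1, -a_2, …, (-1)^(k-1) a_k)`. -/
def alternating {k : ℕ} (a : Fin k → ℝ) : Fin k → ℝ := fun i => (-1) ^ (i : ℕ) * a i

end SignRegular

end

noncomputable section

namespace SignRegular

/-! A sign-change count is certified from both sides: above by consecutive blocks of weakly constant
sign, below by strictly alternating entries.

For 1 → 2, merging the columns of `A` over the blocks of `x`, weighted by `|x_j|`, gives `C` with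
one column per block and `C d = A x`, where `d` alternates with entries ±1. Minors of `C` are
nonnegative combinations of minors of `A`, so they keep their signs (`HasMinorSigns.mergeColumns`).
Too many sign changes in `C d` would make all terms of a vanishing determinant expansion equal in
sign, so the maximal minors vanish and the columns are dependent. A kernel vector then lets one
entry of `d` be cancelled without changing the image, contradicting induction on sign changes. In
the case of equality, Cramer's rule gives the first sign. No approximation by strictly sign regular
matrices is needed.

For 2 → 3, test vectors are extended by zero. For 3 → 1, induction on the size of minors: `A_k y =
det(A_k) α` alternates fully, so `y` must too, and the equality clause reads off the sign of `det
A_k`. -/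

/-! ### Sign changes, blocks and alternations -/

theorem nonzeroSigns_succ {n : ℕ} (x : Fin (n + 1) → ℝ) :
    nonzeroSigns x = if x 0 = 0 then nonzeroSigns (Fin.tail x)
      else SignType.sign (x 0) :: nonzeroSigns (Fin.tail x) := by
  unfold nonzeroSigns Fin.tail
  by_cases h : x 0 = 0 <;> simp [List.ofFn_succ, h]

theorem nonzeroSigns_eq_nil_iff {n : ℕ} (x : Fin n → ℝ) : nonzeroSigns x = [] ↔ x = 0 := by
  unfold nonzeroSigns
  simp [List.filter_eq_nil_iff, List.mem_ofFn, funext_iff]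

theorem signChanges_zero {n : ℕ} : signChanges (0 : Fin n → ℝ) = 0 := by
  have : nonzeroSigns (0 : Fin n → ℝ) = [] := (nonzeroSigns_eq_nil_iff _).2 rfl
  simp [signChanges, this]

theorem sign_mul_self_pos {t : ℝ} (h : t ≠ 0) : 0 < ((SignType.sign t : SignType) : ℝ) * t := by
  rw [sign_mul_self]
  exact abs_pos.2 h

theorem sign_coe_mul_self {t : ℝ} (h : t ≠ 0) :
    ((SignType.sign t : SignType) : ℝ) * ((SignType.sign t : SignType) : ℝ) = 1 := by
  rcases lt_or_gt_of_ne h with h | h <;> simp [h]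

theorem monotone_cons_zero {n : ℕ} {b : Fin n → ℕ} (hb : Monotone b) :
    Monotone (Fin.cons 0 b : Fin (n + 1) → ℕ) := by
  intro i j hij
  induction i using Fin.cases with
  | zero => simp
  | succ i =>
    induction j using Fin.cases with
    | zero => simp at hij
    | succ j => simpa using hb (by simpa using hij)

/-- For a non-zero vector, the number of sign changes and the first sign are witnessed by a
decomposition of the indices into consecutive blocks of alternating weak signs, and by a choice
of indices at which the entries strictly alternate. -/
theorem exists_blocks_and_alternation {n : ℕ} (x : Fin n → ℝ) (hx : x ≠ 0) :
    (firstSign x : ℝ) * (firstSign x : ℝ) = 1 ∧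
    lastSign x = firstSign x * (-1) ^ signChanges x ∧
    (∃ b : Fin n → ℕ, Monotone b ∧ (∀ j, b j ≤ signChanges x) ∧
      ∀ j, 0 ≤ (firstSign x : ℝ) * (-1) ^ b j * x j) ∧
    ∃ g : Fin (signChanges x + 1) ↪o Fin n,
      ∀ j : Fin (signChanges x + 1), 0 < (firstSign x : ℝ) * (-1) ^ (j : ℕ) * x (g j) := by
  induction n with
  | zero => exact absurd (Subsingleton.elim _ _) hx
  | succ n ih =>
    have hns := nonzeroSigns_succ x
    by_cases h0 : x 0 = 0
    · have ht : Fin.tail x ≠ 0 := fun h => hx (funext fun i => by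
        refine Fin.cases h0 (fun i => ?_) i
        exact congrFun h i)
      rw [if_pos h0] at hns
      obtain ⟨h1, h2, ⟨b, hb, hbl, hbs⟩, g, hg⟩ := ih _ ht
      have e1 : signChanges x = signChanges (Fin.tail x) := by simp [signChanges, hns]
      have e2 : firstSign x = firstSign (Fin.tail x) := by simp [firstSign, hns]
      have e3 : lastSign x = lastSign (Fin.tail x) := by simp [lastSign, hns]
      rw [e1, e2, e3]
      -- A leading zero satisfies every weak sign condition, so it joins block 0.
      refine ⟨h1, h2, ⟨Fin.cons 0 b, ?_, ?_, ?_⟩, g.trans (Fin.succOrderEmb n), hg⟩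
      · exact monotone_cons_zero hb
      · intro j; refine Fin.cases (by simp) (fun j => by simpa using hbl j) j
      · intro j; refine Fin.cases (by simp [h0]) (fun j => by simpa [Fin.tail] using hbs j) j
    · rw [if_neg h0] at hns
      have e2 : firstSign x = SignType.sign (x 0) := by simp [firstSign, hns]
      have hpos := sign_mul_self_pos h0
      have hone := sign_coe_mul_self h0
      by_cases ht : Fin.tail x = 0
      · rw [(nonzeroSigns_eq_nil_iff _).2 ht] at hns
        have e1 : signChanges x = 0 := by simp [signChanges, hns]
        have e3 : lastSign x = SignType.sign (x 0) := by simp [lastSign, hns]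
        rw [e1, e2, e3]
        refine ⟨hone, by simp, ⟨fun _ => 0, monotone_const, by simp, ?_⟩,
          Fin.castLEOrderEmb (by omega), ?_⟩
        · intro j
          refine Fin.cases (by simp) (fun j => ?_) j
          have : x j.succ = 0 := congrFun ht j
          simp [this]
        · intro j
          obtain rfl : j = 0 := Fin.ext (by omega)
          simpa using hpos
      · obtain ⟨h1, h2, ⟨b, hb, hbl, hbs⟩, g, hg⟩ := ih _ ht
        obtain ⟨s, l, hsl⟩ : ∃ s l, nonzeroSigns (Fin.tail x) = s :: l :=
          List.exists_cons_of_ne_nil (fun h => ht ((nonzeroSigns_eq_nil_iff _).1 h))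
        have f2 : firstSign (Fin.tail x) = s := by simp [firstSign, hsl]
        have f3 : lastSign x = lastSign (Fin.tail x) := by simp [lastSign, hns, hsl]
        by_cases hs : SignType.sign (x 0) = s
        · have e1 : signChanges x = signChanges (Fin.tail x) := by
            simp [signChanges, hns, hsl, hs, List.destutter_cons']
          rw [e1, f3, h2, e2, hs, ← f2]
          refine ⟨h1, rfl, ⟨Fin.cons 0 b, ?_, ?_, ?_⟩, g.trans (Fin.succOrderEmb n), hg⟩
          · exact monotone_cons_zero hb
          · intro j; refine Fin.cases (by simp) (fun j => by simpa using hbl j) j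
          · intro j
            refine Fin.cases (by rw [f2, ← hs]; simp)
              (fun j => by simpa [Fin.tail] using hbs j) j
        · have e1 : signChanges x = signChanges (Fin.tail x) + 1 := by
            have : 0 < (List.destutter' (· ≠ ·) s l).length :=
              List.length_pos_iff.2 (List.destutter'_ne_nil _ _)
            rw [signChanges, signChanges, hns, hsl, List.destutter_cons_cons, if_pos hs,
              List.destutter_cons', List.length_cons]
            omega
          have hneg : s = - SignType.sign (x 0) := by
            have hs0 : s ≠ 0 := by
              rintro rfl
              rw [f2] at h1
              simp at h1
            have : SignType.sign (x 0) ≠ 0 := by simpa using h0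
            exact (show ∀ u v : SignType, u ≠ v → v ≠ 0 → u ≠ 0 → v = -u by decide) _ _ hs hs0 this
          rw [f2, hneg] at h1 h2 hbs hg
          rw [e1, f3, h2, e2]
          -- The new entry forms block 0 alone; renumbering the other blocks by one absorbs the
          -- flipped first sign.
          refine ⟨hone, by rw [pow_succ]; simp, ⟨Fin.cons 0 (fun j => b j + 1), ?_, ?_, ?_⟩,
            OrderEmbedding.ofStrictMono (Fin.cons 0 (fun j => (g j).succ)) ?_, ?_⟩
          · exact monotone_cons_zero fun i j hij => Nat.succ_le_succ (hb hij)
          · intro j; refine Fin.cases (by simp) (fun j => by simpa using hbl j) j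
          · intro j
            refine Fin.cases (by simp) (fun j => ?_) j
            have := hbs j
            simp only [Fin.cons_succ, pow_succ]
            simpa [Fin.tail] using this
          · intro i j hij
            induction j using Fin.cases with
            | zero => simp at hij
            | succ j =>
              induction i using Fin.cases with
              | zero => simp
              | succ i => simpa using hij
          · intro j
            refine Fin.cases ?_ (fun j => ?_) j
            · change 0 < (SignType.sign (x 0) : ℝ) * (-1) ^ 0 * x 0
              simpa only [pow_zero, mul_one] using hpos
            · change 0 < (SignType.sign (x 0) : ℝ) * (-1) ^ ((j : ℕ) + 1) * x (g j).succ
              have := hg j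
              rw [pow_succ]
              simpa [Fin.tail] using this

/-- Alternating entries bound the number of sign changes from below; if they attain it, they
start with the first sign. -/
theorem le_signChanges_of_alternation {n k : ℕ} {x : Fin n → ℝ} {s : ℝ} (g : Fin (k + 1) ↪o Fin n)
    (hg : ∀ j : Fin (k + 1), 0 < s * (-1) ^ (j : ℕ) * x (g j)) :
    k ≤ signChanges x ∧ (signChanges x = k → 0 < s * firstSign x) := by
  have hx : x ≠ 0 := by
    rintro rfl
    simpa using hg 0
  obtain ⟨h1, -, ⟨b, hb, hbl, hbs⟩, -⟩ := exists_blocks_and_alternation x hx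
  set u : ℝ := (firstSign x : ℝ)
  -- Neighbouring chosen entries have opposite strict signs, so they cannot share a block and the
  -- block number rises at each step. If the bound is attained, the first chosen entry lies in block
  -- 0.
  have key : ∀ j (hj : j < k + 1), j + b (g 0) ≤ b (g ⟨j, hj⟩) := by
    intro j
    induction j with
    | zero => intro _; simp
    | succ j ih =>
      intro hj
      have h := ih (by omega)
      have hle : b (g ⟨j, by omega⟩) ≤ b (g ⟨j + 1, hj⟩) :=
        hb (g.monotone (Fin.mk_le_mk.2 (by omega)))
      have hne : b (g ⟨j, by omega⟩) ≠ b (g ⟨j + 1, hj⟩) := by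
        intro he
        have a1 := hg ⟨j, by omega⟩
        have a2 := hg ⟨j + 1, hj⟩
        have b1 := hbs (g ⟨j, by omega⟩)
        have b2 := hbs (g ⟨j + 1, hj⟩)
        rw [← he] at b2
        simp only [pow_succ] at a2
        generalize x (g ⟨j, by omega⟩) = p at *
        generalize x (g ⟨j + 1, hj⟩) = q at *
        have hbsq : ((-1 : ℝ) ^ b (g ⟨j, by omega⟩)) ^ 2 = 1 := by rw [← pow_mul']; simp
        generalize (-1 : ℝ) ^ b (g ⟨j, by omega⟩) = c at *
        have a3 := mul_pos a1 a2
        have b3 := mul_nonneg b1 b2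
        have hjsq : ((-1 : ℝ) ^ j) ^ 2 = 1 := by rw [← pow_mul']; simp
        have e1 : u * c * p * (u * c * q) = p * q := by
          linear_combination p * q * c ^ 2 * h1 + p * q * hbsq
        have e2 : s * (-1) ^ j * p * (s * ((-1) ^ j * -1) * q) = - (s ^ 2 * (p * q)) := by
          linear_combination - (s ^ 2 * p * q) * hjsq
        rw [e1] at b3
        rw [e2] at a3
        nlinarith [sq_nonneg s]
      omega
  have hk := key k (by omega)
  have hl := hbl (g ⟨k, by omega⟩)
  refine ⟨by omega, fun he => ?_⟩
  have hb0 : b (g 0) = 0 := by omega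
  have a1 := hg 0
  have b1 := hbs (g 0)
  rw [hb0] at b1
  simp only [Fin.val_zero, pow_zero, mul_one] at a1 b1
  have hu : u ≠ 0 := fun h => by simp [h] at h1
  have hp : x (g 0) ≠ 0 := fun h => by simp [h] at a1
  have := mul_pos a1 (lt_of_le_of_ne b1 (mul_ne_zero hu hp).symm)
  have hp2 : 0 < x (g 0) ^ 2 := by positivity
  nlinarith

theorem signChanges_lt_card {n : ℕ} {x : Fin n → ℝ} (hx : x ≠ 0) : signChanges x + 1 ≤ n := by
  obtain ⟨-, -, -, g, -⟩ := exists_blocks_and_alternation x hx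
  simpa using Fintype.card_le_of_embedding g.toEmbedding

/-- A zero entry costs one sign change. -/
theorem signChanges_lt_of_apply_eq_zero {n : ℕ} {x : Fin n → ℝ} (hx : x ≠ 0) {c : Fin n}
    (hc : x c = 0) : signChanges x + 1 < n := by
  obtain ⟨-, -, -, g, hg⟩ := exists_blocks_and_alternation x hx
  have h : ¬ Function.Surjective g := fun h => by
    obtain ⟨j, rfl⟩ := h c
    simpa [hc] using hg j
  simpa using Fintype.card_lt_of_injective_not_surjective g g.injective h

theorem signChanges_comp_le {n k : ℕ} (x : Fin n → ℝ) (J : Fin k ↪o Fin n) (h : x ∘ J ≠ 0) :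
    signChanges (x ∘ J) ≤ signChanges x ∧
    (signChanges (x ∘ J) = signChanges x → 0 < (firstSign (x ∘ J) : ℝ) * firstSign x) := by
  obtain ⟨-, -, -, g, hg⟩ := exists_blocks_and_alternation _ h
  have := le_signChanges_of_alternation (x := x) (g.trans J) hg
  exact ⟨this.1, fun e => this.2 e.symm⟩

theorem extend_zero_ne_zero {n k : ℕ} {y : Fin k → ℝ} (J : Fin k ↪o Fin n) (hy : y ≠ 0) :
    Function.extend J y 0 ≠ 0 := by
  intro h
  apply hy
  rw [← Function.extend_comp J.injective y 0, h]
  rfl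

theorem signChanges_extend_zero {n k : ℕ} {y : Fin k → ℝ} (J : Fin k ↪o Fin n) (hy : y ≠ 0) :
    signChanges (Function.extend J y 0) = signChanges y := by
  have hc : Function.extend J y 0 ∘ J = y := Function.extend_comp J.injective y 0
  apply le_antisymm
  · obtain ⟨-, -, -, g, hg⟩ := exists_blocks_and_alternation _ (extend_zero_ne_zero J hy)
    -- Strictly alternating entries are non-zero, so they avoid the padding.
    have hr : ∀ j, ∃ i, J i = g j := by
      intro j
      by_contra h
      have := hg j
      rw [Function.extend_apply' _ _ _ h] at this
      simp at this
    choose f hf using hr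
    have hmono : StrictMono f := fun i j hij => by
      rw [← J.lt_iff_lt, hf, hf]
      exact g.strictMono hij
    refine (le_signChanges_of_alternation (OrderEmbedding.ofStrictMono f hmono)
      (s := firstSign (Function.extend J y 0)) fun j => ?_).1
    have := hg j
    rwa [← hf, J.injective.extend_apply] at this
  · have := (signChanges_comp_le (Function.extend J y 0) J (by rwa [hc])).1
    rwa [hc] at this

theorem mulVec_extend_zero {m n k : ℕ} (A : Matrix (Fin m) (Fin n) ℝ) (I : Fin k ↪o Fin m)
    (J : Fin k ↪o Fin n) (y : Fin k → ℝ) :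
    A.mulVec (Function.extend J y 0) ∘ I = (A.submatrix I J).mulVec y := by
  funext i
  simp only [Function.comp, Matrix.mulVec, dotProduct, Matrix.submatrix_apply]
  symm
  refine Fintype.sum_of_injective J J.injective _ _ (fun j hj => ?_) (fun j => ?_)
  · rw [Function.extend_apply' _ _ _ (by simpa using hj)]
    simp
  · rw [J.injective.extend_apply]

/-! ### Minor signs and merging of columns -/

/-- Weak sign regularity with real-valued signs `δ`, in all sizes at once. -/
def HasMinorSigns {m n : ℕ} (δ : ℕ → ℝ) (A : Matrix (Fin m) (Fin n) ℝ) : Prop :=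
  ∀ (r : ℕ) (I : Fin r ↪o Fin m) (J : Fin r ↪o Fin n), 0 ≤ δ r * (A.submatrix I J).det

theorem HasMinorSigns.submatrix {m n p q : ℕ} {δ : ℕ → ℝ} {A : Matrix (Fin m) (Fin n) ℝ}
    (h : HasMinorSigns δ A) (I : Fin p ↪o Fin m) (J : Fin q ↪o Fin n) :
    HasMinorSigns δ (A.submatrix I J) := fun r I' J' => h r (I'.trans I) (J'.trans J)

/-- Sum the columns of `A` over the blocks of `b`, with weights `w`. -/
def mergeColumns {m n q : ℕ} (A : Matrix (Fin m) (Fin n) ℝ) (b : Fin n → Fin q) (w : Fin n → ℝ) :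
    Matrix (Fin m) (Fin q) ℝ := Matrix.of fun i c => ∑ j with b j = c, w j * A i j

theorem mergeColumns_mulVec {m n q : ℕ} (A : Matrix (Fin m) (Fin n) ℝ) (b : Fin n → Fin q)
    (w : Fin n → ℝ) (d : Fin q → ℝ) :
    (mergeColumns A b w).mulVec d = A.mulVec (fun j => w j * d (b j)) := by
  funext i
  simp only [Matrix.mulVec, dotProduct, mergeColumns, Matrix.of_apply]
  rw [← Finset.sum_fiberwise (s := Finset.univ) (g := b)]
  refine Finset.sum_congr rfl fun c _ => ?_
  rw [Finset.sum_mul]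
  refine Finset.sum_congr rfl fun j hj => ?_
  rw [(Finset.mem_filter.1 hj).2]
  ring

/-- By multilinearity, a minor of the merged matrix is a sum over choices of one column from each
selected block. Blocks are consecutive, so each choice is increasing and contributes a genuine minor
of `A` with nonnegative weight. -/
theorem HasMinorSigns.mergeColumns {m n q : ℕ} {δ : ℕ → ℝ} {A : Matrix (Fin m) (Fin n) ℝ}
    (h : HasMinorSigns δ A) {b : Fin n → Fin q} (hb : Monotone b) {w : Fin n → ℝ}
    (hw : ∀ j, 0 ≤ w j) : HasMinorSigns δ (mergeColumns A b w) := by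
  intro r I J
  have hdet : ((SignRegular.mergeColumns A b w).submatrix I J).det =
      ∑ f ∈ Fintype.piFinset (fun c : Fin r => Finset.univ.filter fun j => b j = J c),
        (∏ c, w (f c)) * (A.submatrix I f).det := by
    rw [← Matrix.det_transpose]
    have : ((SignRegular.mergeColumns A b w).submatrix I J).transpose =
        fun c => ∑ j with b j = J c, w j • fun i => A (I i) j := by
      funext c i
      simp [SignRegular.mergeColumns, Finset.sum_apply]
    rw [this]
    change Matrix.detRowAlternating.toMultilinearMap _ = _
    rw [MultilinearMap.map_sum_finset]
    refine Finset.sum_congr rfl fun f _ => ?_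
    rw [MultilinearMap.map_smul_univ, smul_eq_mul, ← Matrix.det_transpose (A.submatrix I f)]
    rfl
  rw [hdet, Finset.mul_sum]
  refine Finset.sum_nonneg fun f hf => ?_
  have hf' : ∀ c, b (f c) = J c := fun c => by
    simpa using Fintype.mem_piFinset.1 hf c
  have hmono : StrictMono f := fun c c' hcc => by
    by_contra hlt
    have := hb (not_lt.1 hlt)
    rw [hf', hf', J.le_iff_le] at this
    exact absurd hcc (not_lt.2 this)
  have := h r I (OrderEmbedding.ofStrictMono f hmono)
  rw [OrderEmbedding.coe_ofStrictMono] at this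
  rw [mul_left_comm]
  exact mul_nonneg (Finset.prod_nonneg fun c _ => hw _) this

/-! ### Cofactor expansions and vanishing minors -/

theorem sum_alternating_minors_nonneg {k : ℕ} {e s : ℝ} {v M : Fin k → ℝ}
    (hv : ∀ j : Fin k, 0 ≤ s * (-1) ^ (j : ℕ) * v j) (hM : ∀ j, 0 ≤ e * M j) :
    0 ≤ e * s * ∑ j : Fin k, (-1) ^ (j : ℕ) * v j * M j := by
  rw [Finset.mul_sum]
  refine Finset.sum_nonneg fun j _ => ?_
  have := mul_nonneg (hv j) (hM j)
  linarith

/-- The first row of the adjugate applied to a vector. -/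
theorem adjugate_mulVec_zero {k : ℕ} (B : Matrix (Fin (k + 1)) (Fin (k + 1)) ℝ)
    (v : Fin (k + 1) → ℝ) :
    B.adjugate.mulVec v 0 = ∑ j : Fin (k + 1), (-1) ^ (j : ℕ) * v j *
      (B.submatrix (Fin.succAboveOrderEmb j) (Fin.succAboveOrderEmb 0)).det := by
  simp only [Matrix.mulVec, dotProduct]
  refine Finset.sum_congr rfl fun j _ => ?_
  rw [Matrix.adjugate_fin_succ_eq_det_submatrix]
  simp only [Fin.val_zero, add_zero]
  change _ * (B.submatrix j.succAbove (Fin.succAbove 0)).det * _ =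
    _ * _ * (B.submatrix j.succAbove (Fin.succAbove 0)).det
  ring

/-- If all maximal minors of a `(q + 1) × q` matrix vanish, its columns are dependent. -/
theorem exists_mulVec_eq_zero_of_minors {q : ℕ} (C : Matrix (Fin (q + 1)) (Fin q) ℝ)
    (h : ∀ j : Fin (q + 1), (C.submatrix j.succAbove id).det = 0) : ∃ w ≠ 0, C.mulVec w = 0 := by
  have hns : ¬ Function.Surjective C.mulVecLin := fun hs => by
    have := LinearMap.finrank_le_finrank_of_surjective hs
    simp at this
  simp only [Function.Surjective, not_forall] at hns
  obtain ⟨z, hz⟩ := hns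
  -- Bordering by a vector `z` outside the column space: a kernel vector of `M` cannot involve `z`,
  -- so it is a relation among the columns of `C`.
  let M : Matrix (Fin (q + 1)) (Fin (q + 1)) ℝ := Matrix.of fun i => Fin.cons (z i) (C i)
  have hM : M.det = 0 := by
    rw [Matrix.det_succ_column_zero]
    refine Finset.sum_eq_zero fun j _ => ?_
    have : M.submatrix j.succAbove Fin.succ = C.submatrix j.succAbove id := by
      ext i c; simp [M]
    rw [this, h]
    simp
  obtain ⟨u, hu, hMu⟩ := Matrix.exists_mulVec_eq_zero_iff.2 hM
  have hMu' : ∀ i, z i * u 0 + C.mulVec (Fin.tail u) i = 0 := fun i => by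
    have := congrFun hMu i
    simpa [Matrix.mulVec, dotProduct, Fin.sum_univ_succ, M, Fin.tail] using this
  have hu0 : u 0 = 0 := by
    by_contra hne
    apply hz
    refine ⟨-(u 0)⁻¹ • Fin.tail u, ?_⟩
    funext i
    have := hMu' i
    simp only [Matrix.mulVecLin_apply, Matrix.mulVec_smul, Pi.smul_apply, smul_eq_mul]
    field_simp
    linarith
  refine ⟨Fin.tail u, fun ht => hu (funext fun i => Fin.cases hu0 (fun i => congrFun ht i) i), ?_⟩
  funext i
  simpa [hu0] using hMu' i

/-- If `C d` alternates strictly over `q + 1` rows, `C` having `q` columns and minors of constant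
sign, then all the maximal minors vanish. -/
theorem minors_eq_zero_of_alternating {q : ℕ} {e s : ℝ} (he : e ≠ 0)
    (C : Matrix (Fin (q + 1)) (Fin q) ℝ)
    (hC : ∀ j : Fin (q + 1), 0 ≤ e * (C.submatrix j.succAbove id).det) (d : Fin q → ℝ)
    (hd : ∀ j : Fin (q + 1), 0 < s * (-1) ^ (j : ℕ) * C.mulVec d j) (j : Fin (q + 1)) :
    (C.submatrix j.succAbove id).det = 0 := by
  let M : Matrix (Fin (q + 1)) (Fin (q + 1)) ℝ := Matrix.of fun i => Fin.cons (C.mulVec d i) (C i)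
  have hM : M.det = 0 := by
    refine Matrix.exists_mulVec_eq_zero_iff.1 ⟨Fin.cons (-1) d, fun h => ?_, ?_⟩
    · simpa using congrFun h 0
    · funext i
      simp [Matrix.mulVec, dotProduct, Fin.sum_univ_succ, M]
  rw [Matrix.det_succ_column_zero] at hM
  -- The signs of `C d` cancel the cofactor signs, leaving a zero sum of nonnegative terms.
  have hM' : ∑ j : Fin (q + 1),
      (s * (-1) ^ (j : ℕ) * C.mulVec d j) * (e * (C.submatrix j.succAbove id).det) = 0 := by
    rw [← mul_zero (e * s), ← hM, Finset.mul_sum]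
    refine Finset.sum_congr rfl fun j _ => ?_
    have : M.submatrix j.succAbove Fin.succ = C.submatrix j.succAbove id := by
      ext i c; simp [M]
    rw [this]
    simp only [M, Matrix.of_apply, Fin.cons_zero]
    ring
  have := (Finset.sum_eq_zero_iff_of_nonneg
    fun j _ => mul_nonneg (hd j).le (hC j)).1 hM' j (Finset.mem_univ j)
  simpa [he, (hd j).ne'] using this

/-! ### Variation diminution -/

/-- The variation diminishing property of sign regular matrices. -/
theorem HasMinorSigns.variation_diminishing {δ : ℕ → ℝ} (hδ : ∀ r, δ r * δ r = 1) {m n : ℕ}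
    {A : Matrix (Fin m) (Fin n) ℝ} (hA : HasMinorSigns δ A) (x : Fin n → ℝ)
    (hAx : A.mulVec x ≠ 0) :
    signChanges (A.mulVec x) ≤ signChanges x ∧
    (signChanges (A.mulVec x) = signChanges x →
      0 < δ (signChanges x) * δ (signChanges x + 1) *
        (firstSign (A.mulVec x) : ℝ) * (firstSign x : ℝ)) := by
  -- The matrix is generalized because the hypothesis is applied to row selections of the merged
  -- matrix.
  induction hr : signChanges x using Nat.strong_induction_on generalizing m n with
  | _ r ih =>
  have hx : x ≠ 0 := by
    rintro rfl
    simp at hAx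
  obtain ⟨h1, -, ⟨b, hb, hbl, hbs⟩, -⟩ := exists_blocks_and_alternation x hx
  rw [hr] at hbl
  have hδ0 : ∀ r, δ r ≠ 0 := fun r h => by simpa [h] using hδ r
  set u : ℝ := (firstSign x : ℝ) with hu
  let b' : Fin n → Fin (r + 1) := fun j => ⟨b j, Nat.lt_succ_of_le (hbl j)⟩
  let C := SignRegular.mergeColumns A b' fun j => u * (-1) ^ b j * x j
  let d : Fin (r + 1) → ℝ := fun c => u * (-1) ^ (c : ℕ)
  have hC : HasMinorSigns δ C := hA.mergeColumns (fun i j hij => hb hij) hbs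
  have hCd : C.mulVec d = A.mulVec x := by
    rw [mergeColumns_mulVec]
    congr 1
    funext j
    have : ((-1 : ℝ) ^ b j) ^ 2 = 1 := by rw [← pow_mul']; simp
    change u * (-1) ^ b j * x j * (u * (-1) ^ b j) = x j
    linear_combination x j * ((-1 : ℝ) ^ b j) ^ 2 * h1 + x j * this
  rw [← hCd] at hAx ⊢
  -- A kernel vector `w` would give `d'` with the same image and a zero at `c`. Having `r + 1`
  -- entries, `d'` has fewer than `r` sign changes, against the induction hypothesis.
  have inj : ∀ {p : ℕ} (I : Fin p ↪o Fin m), C.mulVec d ∘ I ≠ 0 →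
      r ≤ signChanges (C.mulVec d ∘ I) → ∀ w, (C.submatrix I id).mulVec w = 0 → w = 0 := by
    intro p I hne hle w hw
    by_contra hw0
    obtain ⟨c, hc⟩ := Function.ne_iff.1 hw0
    simp only [Pi.zero_apply] at hc
    let d' := d - (d c / w c) • w
    have hd' : (C.submatrix I
        (RelEmbedding.refl (· ≤ ·) : Fin (r + 1) ↪o Fin (r + 1))).mulVec d' = C.mulVec d ∘ I := by
      change (C.submatrix I id).mulVec d' = _
      rw [Matrix.mulVec_sub, Matrix.mulVec_smul, hw, smul_zero, sub_zero]
      rfl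
    have hd0 : d' ≠ 0 := fun h => by
      rw [h, Matrix.mulVec_zero] at hd'
      exact hne hd'.symm
    have hlt := signChanges_lt_of_apply_eq_zero hd0 (c := c) (by simp [d', hc])
    have := (ih (signChanges d') (by omega) (hC.submatrix I (RelEmbedding.refl _)) d'
      (by rwa [hd']) rfl).1
    rw [hd'] at this
    omega
  obtain ⟨-, -, -, g, hg⟩ := exists_blocks_and_alternation _ hAx
  refine ⟨?_, ?_⟩
  · by_contra hlt
    have hle : r + 1 + 1 ≤ signChanges (C.mulVec d) + 1 := by omega
    let I := (Fin.castLEOrderEmb hle).trans g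
    have hI : ∀ j : Fin (r + 1 + 1), 0 < (firstSign (C.mulVec d) : ℝ) * (-1) ^ (j : ℕ) *
        (C.submatrix I id).mulVec d j := fun j => hg (Fin.castLE hle j)
    have hch := (le_signChanges_of_alternation (x := C.mulVec d ∘ I) (RelEmbedding.refl _) hI).1
    have hmin := minors_eq_zero_of_alternating (hδ0 (r + 1)) (C.submatrix I id)
      (fun j => hC (r + 1) ((Fin.succAboveOrderEmb j).trans I) (RelEmbedding.refl _)) d hI
    obtain ⟨w, hw0, hw⟩ := exists_mulVec_eq_zero_of_minors _ hmin
    refine hw0 (inj I (fun h => ?_) (by omega) w hw)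
    have := hI 0
    rw [show (C.submatrix I id).mulVec d 0 = 0 from congrFun h 0] at this
    simp at this
  · intro heq
    have hle : r + 1 ≤ signChanges (C.mulVec d) + 1 := by omega
    let I := (Fin.castLEOrderEmb hle).trans g
    set B := C.submatrix I id with hB
    have hI : ∀ j : Fin (r + 1), 0 < (firstSign (C.mulVec d) : ℝ) * (-1) ^ (j : ℕ) *
        B.mulVec d j := fun j => hg (Fin.castLE hle j)
    have hch := (le_signChanges_of_alternation (x := C.mulVec d ∘ I) (RelEmbedding.refl _) hI).1
    have hdet : B.det ≠ 0 := fun h0 => by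
      obtain ⟨w, hw0, hw⟩ := Matrix.exists_mulVec_eq_zero_iff.2 h0
      refine hw0 (inj I (fun h => ?_) hch w hw)
      have := hI 0
      rw [show B.mulVec d 0 = 0 from congrFun h 0] at this
      simp at this
    -- Cramer's rule: `det B * d 0` is the cofactor sum of `B d`, whose terms all share one sign.
    have hadj := adjugate_mulVec_zero B (B.mulVec d)
    rw [Matrix.mulVec_mulVec, Matrix.adjugate_mul, Matrix.smul_mulVec, Matrix.one_mulVec] at hadj
    have hnn := sum_alternating_minors_nonneg (e := δ r) (fun j => (hI j).le)
      (M := fun j => (B.submatrix (Fin.succAboveOrderEmb j) (Fin.succAboveOrderEmb 0)).det)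
      fun j => hC r ((Fin.succAboveOrderEmb j).trans I) (Fin.succAboveOrderEmb 0)
    rw [← hadj] at hnn
    have hdpos := hC (r + 1) I (RelEmbedding.refl _)
    change 0 ≤ δ (r + 1) * B.det at hdpos
    simp only [d, Pi.smul_apply, Fin.val_zero, pow_zero, mul_one, smul_eq_mul] at hnn
    have hu0 : u ≠ 0 := fun h => by simp [h] at h1
    have hf0 : (firstSign (C.mulVec d) : ℝ) ≠ 0 := fun h => by
      have := hI 0
      simp [h] at this
    generalize (firstSign (C.mulVec d) : ℝ) = f at *
    have p1 : 0 < δ (r + 1) * B.det :=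
      lt_of_le_of_ne hdpos (mul_ne_zero (hδ0 _) hdet).symm
    have p2 : 0 < δ r * f * (B.det * u) :=
      lt_of_le_of_ne hnn (mul_ne_zero (mul_ne_zero (hδ0 _) hf0) (mul_ne_zero hdet hu0)).symm
    have p3 : 0 < B.det ^ 2 := by positivity
    have p4 := mul_pos p1 p2
    have e4 : δ (r + 1) * B.det * (δ r * f * (B.det * u)) =
      B.det ^ 2 * (δ r * δ (r + 1) * f * u) := by ring
    rw [e4] at p4
    exact (mul_pos_iff_of_pos_left p3).1 p4

/-! ### The three implications -/

theorem signType_eq_of_pos (a b c d : SignType)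
    (h : 0 < (a : ℝ) * (b : ℝ) * (c : ℝ) * (d : ℝ)) : c = a * b * d := by
  rw [← SignType.coe_mul, ← SignType.coe_mul, ← SignType.coe_mul] at h
  have h' : a * b * c * d = 1 := by
    generalize a * b * c * d = e at h
    cases e <;> simp_all; norm_num at h
  exact (show ∀ a b c d : SignType, a * b * c * d = 1 → c = a * b * d by decide) _ _ _ _ h'

/-- For `VDAt`, the condition on first signs implies the one on last signs. -/
theorem vdAt_of_firstSign {N p q : ℕ} {ε : Fin N → SignType} {B : Matrix (Fin p) (Fin q) ℝ}
    {x : Fin q → ℝ} (h : B.mulVec x ≠ 0 → signChanges (B.mulVec x) ≤ signChanges x ∧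
      (signChanges (B.mulVec x) = signChanges x → signChanges x < min p q →
        firstSign (B.mulVec x) =
          sgn ε (signChanges x) * sgn ε (signChanges x + 1) * firstSign x)) : VDAt ε B x := by
  by_cases h0 : B.mulVec x = 0
  · refine ⟨by rw [h0, signChanges_zero]; exact Nat.zero_le _, fun r h' => absurd h0 h'⟩
  · have hx : x ≠ 0 := by
      rintro rfl
      simp at h0
    refine ⟨(h h0).1, ?_⟩
    rintro r - h1 rfl hlt
    have hf := (h h0).2 h1 hlt
    refine ⟨hf, ?_⟩
    rw [(exists_blocks_and_alternation _ h0).2.1, (exists_blocks_and_alternation _ hx).2.1, hf, h1,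
      mul_assoc]

theorem sgn_mul_self {N : ℕ} {ε : Fin N → SignType} (hε : ∀ i, ε i = 1 ∨ ε i = -1) (r : ℕ) :
    (sgn ε r : ℝ) * (sgn ε r : ℝ) = 1 := by
  unfold sgn
  split_ifs with h
  · rcases hε ⟨r - 1, by omega⟩ with h | h <;> simp [h]
  · simp

theorem HasMinorSigns.vdAt {N p q : ℕ} {ε : Fin N → SignType} (hε : ∀ i, ε i = 1 ∨ ε i = -1)
    {B : Matrix (Fin p) (Fin q) ℝ} (hB : HasMinorSigns (fun r => (sgn ε r : ℝ)) B)
    (x : Fin q → ℝ) : VDAt ε B x := by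
  refine vdAt_of_firstSign fun h0 => ?_
  have := hB.variation_diminishing (sgn_mul_self hε) x h0
  exact ⟨this.1, fun h _ => signType_eq_of_pos _ _ _ _ (this.2 h)⟩

/-- Size 0 is consistent since ε_0 = 1 is the sign of the empty determinant; beyond `min m n` there
are no minors, so the default value of `sgn` is harmless. -/
theorem IsSR.hasMinorSigns {m n : ℕ} {ε : Fin (min m n) → SignType}
    {A : Matrix (Fin m) (Fin n) ℝ} (h : IsSR ε A) :
    HasMinorSigns (fun r => (sgn ε r : ℝ)) A := by
  intro r I J
  rcases Nat.eq_zero_or_pos r with rfl | hr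
  · simp [sgn]
  · by_cases h0 : (A.submatrix I J).det = 0
    · simp [h0]
    · have h1 : r ≤ m := by simpa using Fintype.card_le_of_embedding I.toEmbedding
      have h2 : r ≤ n := by simpa using Fintype.card_le_of_embedding J.toEmbedding
      have := h r hr (le_min h1 h2) I J h0
      beta_reduce
      rw [← this]
      exact (sign_mul_self_pos h0).le

/-- The variation diminishing condition passes to square submatrices. -/
theorem vdAt_submatrix {N m n k : ℕ} {ε : Fin N → SignType} {A : Matrix (Fin m) (Fin n) ℝ}
    (h : ∀ x, VDAt ε A x) (I : Fin k ↪o Fin m) (J : Fin k ↪o Fin n) (y : Fin k → ℝ) :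
    VDAt ε (A.submatrix I J) y := by
  refine vdAt_of_firstSign fun h0 => ?_
  have hy : y ≠ 0 := by
    rintro rfl
    simp at h0
  have hS := signChanges_extend_zero J hy
  have hc : Function.extend J y 0 ∘ J = y := Function.extend_comp J.injective y 0
  have hF := signChanges_comp_le (Function.extend J y 0) J (by rwa [hc])
  rw [hc, hS] at hF
  have hI := mulVec_extend_zero A I J y
  rw [← hI] at h0 ⊢
  have hG := signChanges_comp_le _ I h0
  have hA := h (Function.extend J y 0)
  have hle := hA.1
  rw [hS] at hle
  refine ⟨hG.1.trans hle, fun he hlt => ?_⟩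
  -- Equality at both ends of the chain forces equality throughout, so restriction preserves the
  -- first signs.
  have heA : signChanges (A.mulVec (Function.extend J y 0)) = signChanges y :=
    le_antisymm hle (he ▸ hG.1)
  have hkm : k ≤ m := by simpa using Fintype.card_le_of_embedding I.toEmbedding
  have hkn : k ≤ n := by simpa using Fintype.card_le_of_embedding J.toEmbedding
  have hA0 : A.mulVec (Function.extend J y 0) ≠ 0 := fun h => h0 (by rw [h]; rfl)
  have hf := (hA.2 _ hA0 heA hS (by omega)).1
  have f1 := signType_eq_of_pos 1 1 _ _ (by simpa using hF.2 rfl)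
  have f2 := signType_eq_of_pos 1 1 _ _ (by simpa using hG.2 (he.trans heA.symm))
  simp only [one_mul] at f1 f2
  rw [f2, hf, f1]

/-- If the variation diminishing condition holds for the adjugate test vectors of all square
submatrices, the matrix is sign regular. -/
theorem isSR_of_vdAt_adjugate {m n : ℕ} {A : Matrix (Fin m) (Fin n) ℝ}
    {ε : Fin (min m n) → SignType} (hε : ∀ i, ε i = 1 ∨ ε i = -1)
    {a : ∀ k : ℕ, (Fin k ↪o Fin m) → (Fin k ↪o Fin n) → Fin k → ℝ}
    (ha : ∀ k I J i, 0 < a k I J i)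
    (h : ∀ k : ℕ, 1 ≤ k → k ≤ min m n → ∀ (I : Fin k ↪o Fin m) (J : Fin k ↪o Fin n),
      VDAt ε (A.submatrix I J) ((A.submatrix I J).adjugate.mulVec (alternating (a k I J)))) :
    IsSR ε A := by
  have key : ∀ r ≤ min m n, ∀ (I : Fin r ↪o Fin m) (J : Fin r ↪o Fin n),
      0 ≤ (sgn ε r : ℝ) * (A.submatrix I J).det := by
    intro r
    induction r with
    | zero => intro _ I J; simp [sgn]
    | succ k ih =>
      intro hk I J
      have hvd := h (k + 1) (by omega) hk I J
      set B := A.submatrix I J with hB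
      set v := alternating (a (k + 1) I J) with hv
      by_cases hdet : B.det = 0
      · simp [hdet]
      set y := B.adjugate.mulVec v with hy
      have hBy : B.mulVec y = B.det • v := by
        rw [hy, Matrix.mulVec_mulVec, Matrix.mul_adjugate, Matrix.smul_mulVec, Matrix.one_mulVec]
      have hvpos : ∀ j : Fin (k + 1), (-1) ^ (j : ℕ) * v j = a (k + 1) I J j := fun j => by
        have : ((-1 : ℝ) ^ (j : ℕ)) ^ 2 = 1 := by rw [← pow_mul']; simp
        simp only [hv, alternating]
        linear_combination a (k + 1) I J j * this
      -- `B y = det B • v` alternates in every entry, starting with the sign of `det B`.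
      have halt : ∀ j : Fin (k + 1), 0 < B.det * (-1) ^ (j : ℕ) * B.mulVec y j := fun j => by
        have hp := mul_pos (show 0 < B.det ^ 2 by positivity) (ha (k + 1) I J j)
        rw [← hvpos] at hp
        rw [hBy, Pi.smul_apply, smul_eq_mul]
        linarith
      have hS := le_signChanges_of_alternation (RelEmbedding.refl _) halt
      have hBy0 : B.mulVec y ≠ 0 := fun h0 => by
        have := halt 0
        simp [h0] at this
      have hy0 : y ≠ 0 := fun h0 => hBy0 (by rw [h0, Matrix.mulVec_zero])
      have hSy : signChanges y = k := by
        have := signChanges_lt_card hy0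
        have := hvd.1
        omega
      have hSB : signChanges (B.mulVec y) = k := by
        have := hvd.1
        omega
      have hf := (hvd.2 k hBy0 hSB hSy (by simp)).1
      have hy00 : y 0 ≠ 0 := fun h0 => by
        have := signChanges_lt_of_apply_eq_zero hy0 h0
        omega
      have hsum := adjugate_mulVec_zero B v
      -- The alternation of `v` cancels the cofactor signs, so `y 0` is a positive combination of `k
      -- × k` minors, whose sign is known by induction.
      have hnn := sum_alternating_minors_nonneg (e := (sgn ε k : ℝ)) (s := 1) (v := v)
        (M := fun j => (B.submatrix (Fin.succAboveOrderEmb j) (Fin.succAboveOrderEmb 0)).det)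
        (fun j => by rw [one_mul, hvpos]; exact (ha _ _ _ _).le)
        fun j => ih (by omega) ((Fin.succAboveOrderEmb j).trans I)
          ((Fin.succAboveOrderEmb 0).trans J)
      rw [← hsum, ← hy, mul_one] at hnn
      obtain ⟨h1, -, -, g, hg⟩ := exists_blocks_and_alternation y hy0
      -- With `k` sign changes in `k + 1` entries, the alternation uses every index, so `y 0`
      -- carries the first sign.
      have hg0 : g 0 = 0 := by
        have hsurj : Function.Surjective g :=
          ((Fintype.bijective_iff_injective_and_card g).2 ⟨g.injective, by simp [hSy]⟩).2
        obtain ⟨j, hj⟩ := hsurj 0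
        exact le_antisymm (hj ▸ g.monotone (Fin.zero_le j)) (Fin.zero_le _)
      have hfy := hg 0
      rw [hg0] at hfy
      simp only [Fin.val_zero, pow_zero, mul_one] at hfy
      have hfB := hS.2 hSB
      rw [hf] at hfB
      push_cast at hfB
      have p := mul_nonneg hnn (mul_pos hfB hfy).le
      have hk1 := sgn_mul_self hε k
      have hyy : 0 < y 0 ^ 2 := by positivity
      have e : (sgn ε k : ℝ) * y 0 * (B.det * ((sgn ε k : ℝ) * (sgn ε (k + 1) : ℝ) *
          (firstSign y : ℝ)) * ((firstSign y : ℝ) * y 0)) =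
          y 0 ^ 2 * ((sgn ε (k + 1) : ℝ) * B.det) := by
        linear_combination (y 0 ^ 2 * (sgn ε (k + 1) : ℝ) * B.det) *
          ((firstSign y : ℝ) * (firstSign y : ℝ)) * hk1 +
          (y 0 ^ 2 * (sgn ε (k + 1) : ℝ) * B.det) * h1
      rw [e] at p
      exact (mul_nonneg_iff_of_pos_left hyy).1 p
  intro r _ hr I J hdet
  have hk := key r hr I J
  have hs := sgn_mul_self hε r
  have hs0 : (sgn ε r : ℝ) ≠ 0 := fun h => by simp [h] at hs
  have hp := lt_of_le_of_ne hk (mul_ne_zero hs0 hdet).symm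
  refine signType_eq_of_pos 1 1 _ _ ?_ |>.trans (one_mul _ |>.trans rfl)
  have hq := sign_mul_self_pos hdet
  have hd2 : 0 < (A.submatrix I J).det ^ 2 := by positivity
  have := mul_pos hq hp
  simp only [SignType.coe_one, one_mul]
  refine (mul_pos_iff_of_pos_left hd2).1 ?_
  linarith

end SignRegular

end

/-- `a k I J` is the positive vector chosen for the `k × k` submatrix with rows `I` and columns
`J`; the equivalence holds for every such choice, so that one arbitrary alternating test vector
per square submatrix suffices. -/
theorem theoremC {m n : ℕ} (hm : 1 ≤ m) (hn : 1 ≤ n) (A : Matrix (Fin m) (Fin n) ℝ)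
    (ε : Fin (min m n) → SignType) (hε : ∀ i, ε i = 1 ∨ ε i = -1)
    (a : ∀ k : ℕ, (Fin k ↪o Fin m) → (Fin k ↪o Fin n) → Fin k → ℝ)
    (ha : ∀ k I J i, 0 < a k I J i) :
    List.TFAE [
      SignRegular.IsSR ε A,
      ∀ x : Fin n → ℝ, SignRegular.VDAt ε A x,
      ∀ k : ℕ, 1 ≤ k → k ≤ min m n → ∀ (I : Fin k ↪o Fin m) (J : Fin k ↪o Fin n),
        SignRegular.VDAt ε (A.submatrix I J)
          ((A.submatrix I J).adjugate.mulVec (SignRegular.alternating (a k I J)))] := by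
  tfae_have 1 → 2 := fun h x => h.hasMinorSigns.vdAt hε x
  tfae_have 2 → 3 := fun h k _ _ I J => SignRegular.vdAt_submatrix h I J _
  tfae_have 3 → 1 := SignRegular.isSR_of_vdAt_adjugate hε ha
  tfae_finish
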